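/- Let $2^{\mathbb N}$ be the Cantor group, i.e. the set of all sequences of elements of $\mathbb Z/2$ with coordinatewise addition, the product topology, and the product probability measure $\mu$ of the uniform measures on $\{0,1\}$ (null means $\mu$-null). A set $A\subseteq 2^{\mathbb N}$ is called - countably perfectly meager in $2^{\mathbb N}$ if for every sequence $(P_n)_{n\in\mathbb N}$ of perfect subsets of $2^{\mathbb N}$ (non-empty, closed, without isolated points) there is an $F_\sigma$-set $F\subseteq 2^{\mathbb N}$ such that $A\subseteq F$ and $F\cap P_n$ is meager in $P_n$ for each $n$; - meager-additive if $A+M$ is meager for every meager set $M\subseteq 2^{\mathbb N}$; - a $\gamma$-set if for every family $\mathcal U$ of open sets such that each finite subset of $A$ is contained in some member of $\mathcal U$, there is a sequence $(U_n)_{n\in\mathbb N}$ of members of $\mathcal U$ such that every $x\in A$ belongs to $U_n$ for all but finitely many $n$; - strongly meager if $A+N\neq 2^{\mathbb N}$ for every null set $N\subseteq 2^{\mathbb N}$; - a Sierpiński set if $A$ is uncountable and $A\cap N$ is countable for every null set $N\subseteq 2^{\mathbb N}$. Then every subset $A$ of $2^{\mathbb N}$ which is (1) meager-additive, or (2) a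 $\gamma$-set, or (3) strongly meager, or (4) a Sierpiński set, is countably perfectly meager in $2^{\mathbb N}$. -/

import Mathlib

open scoped Pointwise

/-- The Cantor group `2^ℕ`: binary sequences with coordinatewise addition modulo `2` and the
product of the discrete topologies. -/
abbrev CantorGroup : Type := ℕ → ZMod 2

/-- The product measure on `2^ℕ` of the uniform probability measures on `{0, 1}`. -/
noncomputable def coinMeasure : MeasureTheory.Measure CantorGroup :=
  MeasureTheory.Measure.infinitePi fun _ : ℕ => (PMF.uniformOfFintype (ZMod 2)).toMeasure

/-- `F` is an `F_σ`-set: a countable union of closed sets. -/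
def IsFSigma {X : Type*} [TopologicalSpace X] (F : Set X) : Prop :=
  ∃ C : ℕ → Set X, (∀ n, IsClosed (C n)) ∧ F = ⋃ n, C n

/-- `F ∩ P` is meager in the subspace `P`. -/
def IsMeagerIn {X : Type*} [TopologicalSpace X] (F P : Set X) : Prop :=
  IsMeagre {p : P | (p : X) ∈ F}

/-- `A` is countably perfectly meager in `X`: for every sequence of (non-empty) perfect sets `P n`
there is an `F_σ`-set `F ⊇ A` such that `F ∩ P n` is meager in `P n` for every `n`. -/
def CountablyPerfectlyMeager {X : Type*} [TopologicalSpace X] (A : Set X) : Prop :=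
  ∀ P : ℕ → Set X, (∀ n, (P n).Nonempty ∧ Perfect (P n)) →
    ∃ F : Set X, IsFSigma F ∧ A ⊆ F ∧ ∀ n, IsMeagerIn F (P n)

/-- `A + M` is meager for every meager set `M`. -/
def MeagerAdditive (A : Set CantorGroup) : Prop :=
  ∀ M : Set CantorGroup, IsMeagre M → IsMeagre (A + M)

/-- `𝒰` is an open `ω`-cover of `A`: a family of open sets such that every finite subset of `A`
is contained in a member of the family. -/
def IsOpenOmegaCover {X : Type*} [TopologicalSpace X] (A : Set X) (𝒰 : Set (Set X)) : Prop :=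
  (∀ U ∈ 𝒰, IsOpen U) ∧ ∀ E : Set X, E.Finite → E ⊆ A → ∃ U ∈ 𝒰, E ⊆ U

/-- `A` is a `γ`-set: from every open `ω`-cover of `A` one can choose a sequence `U n` such that
every point of `A` belongs to all but finitely many of the `U n`. -/
def IsGammaSet {X : Type*} [TopologicalSpace X] (A : Set X) : Prop :=
  ∀ 𝒰 : Set (Set X), IsOpenOmegaCover A 𝒰 →
    ∃ U : ℕ → Set X, (∀ n, U n ∈ 𝒰) ∧ ∀ x ∈ A, ∀ᶠ n in Filter.atTop, x ∈ U n

/-- `A + N ≠ 2^ℕ` for every null set `N`. -/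
def StronglyMeager (A : Set CantorGroup) : Prop :=
  ∀ N : Set CantorGroup, coinMeasure N = 0 → A + N ≠ Set.univ

/-- `A` is a Sierpiński set: uncountable, with countable intersection with every null set. -/
def IsSierpinskiSet (A : Set CantorGroup) : Prop :=
  ¬ A.Countable ∧ ∀ N : Set CantorGroup, coinMeasure N = 0 → (A ∩ N).Countable

open Set Filter Topology

/-! ### A criterion for being countably perfectly meager -/

/-! All four cases use one criterion. List the basic open pieces of the given perfect sets as `R j`,
each repeated infinitely often; a closed set containing only finitely many `R j` then has empty
interior in every given perfect set, so it suffices to cover `A` by countably many such closed sets.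
For γ-sets the cover consists of tail intersections of closures from a suitable ω-cover. For
strongly meager and Sierpiński sets, a counting argument (`exists_cover_by_translates`) gives open
`U j` of measure at most `2⁻ʲ` meeting every `x - R j`; as the limsup of the `U j` is null, most
points lie in the closed sets `{a | ∀ j ≥ k, x - a ∉ U j}`. For meager-additive sets one takes a
closed nowhere dense `M` such that the sum of any `R j` with any relatively open piece of `M` is
somewhere dense (`exists_add_notMem_of_split`), and applies Baire's theorem inside `M`. -/

lemma Preperfect.infinite {X : Type*} [TopologicalSpace X] [T1Space X] {R : Set X}
    (hR : Preperfect R) (hne : R.Nonempty) : R.Infinite := by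
  intro hfin
  obtain ⟨x, hx⟩ := hne
  have hopen : IsOpen (R \ {x})ᶜ := (hfin.subset sdiff_subset).isClosed.isOpen_compl
  obtain ⟨y, ⟨hy, hyR⟩, hyx⟩ :=
    preperfect_iff_nhds.1 hR x hx _ (hopen.mem_nhds (by simp))
  exact hy ⟨hyR, hyx⟩

lemma isFSigma_iUnion {X ι : Type*} [TopologicalSpace X] [Countable ι] {C : ι → Set X}
    (hC : ∀ i, IsClosed (C i)) : IsFSigma (⋃ i, C i) := by
  rcases isEmpty_or_nonempty ι with h | h
  · exact ⟨fun _ => ∅, fun _ => isClosed_empty, by simp⟩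
  · obtain ⟨e, he⟩ := exists_surjective_nat ι
    exact ⟨fun n => C (e n), fun n => hC _, (he.iUnion_comp C).symm⟩

lemma isMeagerIn_iUnion {X ι : Type*} [TopologicalSpace X] [Countable ι] {C : ι → Set X}
    {P : Set X} (hC : ∀ i, IsClosed (C i))
    (hP : ∀ i (U : Set X), IsOpen U → (U ∩ P).Nonempty → ¬ U ∩ P ⊆ C i) :
    IsMeagerIn (⋃ i, C i) P := by
  have h : {p : P | (p : X) ∈ ⋃ i, C i} = ⋃ i, ((↑) : P → X) ⁻¹' C i := by
    ext; simp
  rw [IsMeagerIn, h]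
  refine isMeagre_iUnion fun i => IsNowhereDense.isMeagre ?_
  rw [((hC i).preimage continuous_subtype_val).isNowhereDense_iff,
    eq_empty_iff_forall_notMem]
  intro x hx
  obtain ⟨V, hV, hVo, hxV⟩ := mem_interior.1 hx
  obtain ⟨U, hU, rfl⟩ := isOpen_induced_iff.1 hVo
  exact hP i U hU ⟨x, hxV, x.2⟩ fun y hy => hV (show (⟨y, hy.2⟩ : P) ∈ _ from hy.1)

/-- The nonempty basic open pieces of countably many perfect sets, listed with infinite
repetition. -/
lemma exists_seq_preperfect {X : Type*} [TopologicalSpace X] [SecondCountableTopology X]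
    {P : ℕ → Set X} (hP : ∀ n, (P n).Nonempty ∧ Preperfect (P n)) :
    ∃ R : ℕ → Set X, (∀ j, (R j).Nonempty ∧ Preperfect (R j)) ∧
      ∀ n U, IsOpen U → (U ∩ P n).Nonempty → ∃ᶠ j in atTop, R j ⊆ U ∩ P n := by
  classical
  let B := TopologicalSpace.countableBasis X
  have hB := TopologicalSpace.isBasis_countableBasis X
  let S := {s : ℕ × B // ((s.2 : Set X) ∩ P s.1).Nonempty}
  have hsub : ∀ n U, IsOpen U → (U ∩ P n).Nonempty →
      ∃ s : S, (s.1.2 : Set X) ∩ P s.1.1 ⊆ U ∩ P n := by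
    rintro n U hU ⟨x, hxU, hxP⟩
    obtain ⟨b, hb, hxb, hbU⟩ := hB.exists_subset_of_mem_open hxU hU
    exact ⟨⟨(n, ⟨b, hb⟩), x, hxb, hxP⟩, inter_subset_inter_left _ hbU⟩
  have : Nonempty S := by
    obtain ⟨x, hx⟩ := (hP 0).1
    exact ⟨(hsub 0 univ isOpen_univ ⟨x, mem_univ x, hx⟩).choose⟩
  have : Countable B := (TopologicalSpace.countable_countableBasis X).to_subtype
  obtain ⟨e, he⟩ := exists_surjective_nat S
  -- The first component of `j.unpair` selects the piece; the second only makes it recur.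
  refine ⟨fun j => ((e j.unpair.1).1.2 : Set X) ∩ P (e j.unpair.1).1.1, fun j =>
    ⟨(e j.unpair.1).2, (hP _).2.open_inter (hB.isOpen (e j.unpair.1).1.2.2)⟩, ?_⟩
  intro n U hU hne
  obtain ⟨s, hs⟩ := hsub n U hU hne
  obtain ⟨a, rfl⟩ := he s
  refine frequently_atTop.2 fun k => ⟨Nat.pair a k, Nat.right_le_pair a k, ?_⟩
  simpa using hs

/-- If for every sequence of perfect pieces `R j` the set `A` can be covered by countably many
closed sets each of which contains only finitely many `R j`, then `A` is countably perfectly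
meager. -/
lemma countablyPerfectlyMeager_of_cover {X : Type*} [TopologicalSpace X]
    [SecondCountableTopology X] {A : Set X}
    (h : ∀ R : ℕ → Set X, (∀ j, (R j).Nonempty ∧ Preperfect (R j)) →
      ∃ (ι : Type) (_ : Countable ι) (C : ι → Set X), (∀ i, IsClosed (C i)) ∧ A ⊆ ⋃ i, C i ∧
        ∀ i, ∀ᶠ j in atTop, ¬ R j ⊆ C i) :
    CountablyPerfectlyMeager A := by
  intro P hP
  obtain ⟨R, hR, hRP⟩ := exists_seq_preperfect fun n => ⟨(hP n).1, (hP n).2.acc⟩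
  obtain ⟨ι, hι, C, hC, hAC, hCR⟩ := h R hR
  refine ⟨⋃ i, C i, isFSigma_iUnion hC, hAC, fun n => isMeagerIn_iUnion hC ?_⟩
  intro i U hU hne hsub
  obtain ⟨j, hj, hj'⟩ := ((hRP n U hU hne).and_eventually (hCR i)).exists
  exact hj' (hj.trans hsub)

lemma Set.Countable.countablyPerfectlyMeager {A : Set CantorGroup} (hA : A.Countable) :
    CountablyPerfectlyMeager A := by
  intro P hP
  have := hA.to_subtype
  refine ⟨⋃ a : A, {(a : CantorGroup)}, isFSigma_iUnion fun _ => isClosed_singleton,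
    fun a ha => mem_iUnion.2 ⟨⟨a, ha⟩, rfl⟩,
    fun n => isMeagerIn_iUnion (fun _ => isClosed_singleton) ?_⟩
  intro a U hU hne hsub
  exact ((hP n).2.acc.open_inter hU).infinite hne ((finite_singleton _).subset hsub)

/-! ### `γ`-sets -/

theorem IsGammaSet.countablyPerfectlyMeager {A : Set CantorGroup} (hA : IsGammaSet A) :
    CountablyPerfectlyMeager A := by
  by_cases hcount : A.Countable
  · exact hcount.countablyPerfectlyMeager
  have hinf : A.Infinite := fun h => hcount h.countable
  let a : ℕ ↪ A := hinf.natEmbedding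
  refine countablyPerfectlyMeager_of_cover fun R hR => ?_
  -- The omitted point `a n` forces `n` to grow: a sequence eventually containing each `a m` must
  -- have its indices `n` tend to infinity, so every `R j` eventually fails to fit.
  let 𝒰 : Set (Set CantorGroup) :=
    {U | IsOpen U ∧ ∃ n, (a n : CantorGroup) ∉ U ∧ ∀ j ≤ n, ¬ R j ⊆ closure U}
  have h𝒰 : IsOpenOmegaCover A 𝒰 := by
    refine ⟨fun U hU => hU.1, fun E hE _ => ?_⟩
    have hpre : ((fun n => (a n : CantorGroup)) ⁻¹' E).Finite :=
      hE.preimage ((Subtype.val_injective.comp a.injective).injOn)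
    obtain ⟨n, hn⟩ := hpre.exists_notMem
    have hr : ∀ j, ∃ r ∈ R j, r ∉ E := fun j =>
      (((hR j).2.infinite (hR j).1).sdiff hE).nonempty
    choose r hrR hrE using hr
    let D : Set CantorGroup := insert (a n : CantorGroup) (r '' Iic n)
    have hD : D.Finite := ((finite_Iic n).image r).insert _
    have hED : Disjoint E D := by
      rw [Set.disjoint_right]
      rintro x (rfl | ⟨j, -, rfl⟩)
      exacts [hn, hrE j]
    obtain ⟨U, W, hU, hW, hEU, hDW, hUW⟩ :=
      SeparatedNhds.of_isCompact_isCompact hE.isCompact hD.isCompact hED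
    have hcl : Disjoint (closure U) W := hUW.closure_left hW
    refine ⟨U, ⟨hU, n, fun h => Set.disjoint_left.1 hUW h (hDW (mem_insert _ _)), ?_⟩, hEU⟩
    intro j hj hsub
    exact Set.disjoint_left.1 hcl (hsub (hrR j)) (hDW (mem_insert_of_mem _ ⟨j, hj, rfl⟩))
  obtain ⟨U, hU, hUA⟩ := hA 𝒰 h𝒰
  choose hUo n hn hnR using hU
  refine ⟨ℕ, inferInstance, fun k => ⋂ i ≥ k, closure (U i),
    fun k => isClosed_biInter fun _ _ => isClosed_closure, ?_, ?_⟩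
  · intro x hx
    obtain ⟨k, hk⟩ := eventually_atTop.1 (hUA x hx)
    exact mem_iUnion.2 ⟨k, mem_iInter₂.2 fun i hi => subset_closure (hk i hi)⟩
  · intro k
    refine Eventually.of_forall fun j hsub => ?_
    have hev : ∀ᶠ i in atTop, ∀ m ∈ Finset.range j, (a m : CantorGroup) ∈ U i :=
      (Finset.eventually_all _).2 fun m _ => hUA _ (a m).2
    obtain ⟨i, hi, hik⟩ := (hev.and (eventually_ge_atTop k)).exists
    have hjn : j ≤ n i := by
      by_contra hlt
      exact hn i (hi _ (Finset.mem_range.2 (not_le.1 hlt)))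
    exact hnR i j hjn (hsub.trans (biInter_subset_of_mem (s := {i | i ≥ k}) hik))

/-! ### Small sets whose translates by an infinite set cover the Cantor group -/

/-- Averaging over `u`: each `w` lies in exactly `K.card` translates of `K`. -/
lemma exists_translate_inter_large {G : Type*} [AddCommGroup G] [Fintype G] [DecidableEq G]
    (K W : Finset G) :
    ∃ u : G, K.card * W.card ≤ Fintype.card G * (W.filter fun w => w - u ∈ K).card := by
  have hsum : ∑ u : G, (W.filter fun w => w - u ∈ K).card = K.card * W.card := by
    simp only [Finset.card_filter]
    rw [Finset.sum_comm, mul_comm, ← smul_eq_mul, ← Finset.sum_const]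
    refine Finset.sum_congr rfl fun w _ => ?_
    rw [← Finset.card_filter]
    refine Finset.card_bij' (fun u _ => w - u) (fun k _ => w - k) ?_ ?_ ?_ ?_ <;> simp
  by_contra! h
  have := Finset.sum_lt_sum_of_nonempty Finset.univ_nonempty fun u (_ : u ∈ Finset.univ) => h u
  rw [← Finset.mul_sum, hsum, Finset.sum_const, Finset.card_univ, smul_eq_mul] at this
  exact lt_irrefl _ this

/-- The greedy algorithm: `W` is covered by few translates of `K`. -/
lemma exists_cover_by_translates {G : Type*} [AddCommGroup G] [Fintype G] [DecidableEq G]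
    {K : Finset G} (hK : K.Nonempty) {δ : ℝ} (hδ : 0 < δ) (W : Finset G) :
    ∃ U : Finset G, (∀ w ∈ W, ∃ k ∈ K, w - k ∈ U) ∧
      (U.card : ℝ) ≤ W.card / (K.card * δ) + δ * Fintype.card G := by
  have hG : (0 : ℝ) < Fintype.card G := by exact_mod_cast Fintype.card_pos
  have hKc : (0 : ℝ) < K.card := by exact_mod_cast hK.card_pos
  induction W using Finset.strongInduction with
  | H W ih =>
  -- A small remainder is covered pointwise, giving the second term of the bound. Otherwise one
  -- translate catches at least `K.card * δ` points, so the first term drops by at least 1.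
  by_cases hW : (W.card : ℝ) ≤ δ * Fintype.card G
  · obtain ⟨k, hk⟩ := hK
    refine ⟨W.image fun w => w - k, fun w hw => ⟨k, hk, Finset.mem_image_of_mem _ hw⟩, ?_⟩
    have h1 : ((W.image fun w => w - k).card : ℝ) ≤ W.card := by
      exact_mod_cast Finset.card_image_le
    have h2 : 0 ≤ W.card / (K.card * δ) := by positivity
    linarith
  · push Not at hW
    obtain ⟨u, hu⟩ := exists_translate_inter_large K W
    have hu' : (K.card * W.card : ℝ) ≤
        Fintype.card G * (W.filter fun w => w - u ∈ K).card := by exact_mod_cast hu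
    have hlarge : K.card * δ ≤ (W.filter fun w => w - u ∈ K).card := by
      refine le_of_mul_le_mul_left ?_ hG
      calc (Fintype.card G : ℝ) * (K.card * δ) = K.card * (δ * Fintype.card G) := by ring
        _ ≤ K.card * W.card := by gcongr
        _ ≤ _ := hu'
    have hcard : ((W.filter fun w => w - u ∈ K).card : ℝ) +
        (W.filter fun w => ¬ w - u ∈ K).card = W.card := by
      exact_mod_cast Finset.card_filter_add_card_filter_not (s := W) (fun w => w - u ∈ K)
    have hpos : (0 : ℝ) < K.card * δ := by positivity
    have hlt : (W.filter fun w => ¬ w - u ∈ K) ⊂ W := by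
      refine (Finset.filter_subset _ _).ssubset_of_ne fun heq => ?_
      rw [heq] at hcard
      linarith
    obtain ⟨U, hUW, hUc⟩ := ih _ hlt
    refine ⟨insert u U, fun w hw => ?_, ?_⟩
    · by_cases hwu : w - u ∈ K
      · exact ⟨w - u, hwu, by simp⟩
      · obtain ⟨k, hk, hkU⟩ := hUW w (Finset.mem_filter.2 ⟨hw, hwu⟩)
        exact ⟨k, hk, Finset.mem_insert_of_mem hkU⟩
    · have h1 : ((insert u U).card : ℝ) ≤ U.card + 1 := by
        exact_mod_cast Finset.card_insert_le u U
      have h2 : ((W.filter fun w => ¬ w - u ∈ K).card : ℝ) / (K.card * δ) + 1 ≤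
          W.card / (K.card * δ) := by
        rw [div_add_one hpos.ne']
        gcongr
        linarith
      linarith

lemma coinMeasure_cylinder_le (n : ℕ) (u : Fin n → ZMod 2) :
    coinMeasure {x | ∀ i : Fin n, x i = u i} ≤ (2 ^ n : ENNReal)⁻¹ := by
  let v : ℕ → ZMod 2 := fun i => if h : i < n then u ⟨i, h⟩ else 0
  have hset : {x : CantorGroup | ∀ i : Fin n, x i = u i} =
      Set.pi (Finset.range n : Set ℕ) fun i => {v i} := by
    ext x
    simp only [mem_ofPred_eq, Set.mem_pi, Finset.coe_range, mem_Iio, mem_singleton_iff, v]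
    exact ⟨fun h i hi => by simpa [hi] using h ⟨i, hi⟩,
      fun h i => by simpa [i.2] using h i i.2⟩
  rw [hset, coinMeasure, MeasureTheory.Measure.infinitePi_pi _ fun _ _ => measurableSet_singleton _]
  simp [PMF.uniformOfFintype_apply, ENNReal.inv_pow]

lemma exists_injOn_restrict (K : Finset CantorGroup) :
    ∃ n : ℕ, Set.InjOn (fun (x : CantorGroup) (i : Fin n) => x i) K := by
  have h : ∀ p ∈ K ×ˢ K, ∀ᶠ n : ℕ in atTop,
      (∀ i : Fin n, p.1 i = p.2 i) → p.1 = p.2 := by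
    intro p _
    by_cases hp : p.1 = p.2
    · exact Eventually.of_forall fun _ _ => hp
    · obtain ⟨i, hi⟩ := Function.ne_iff.1 hp
      filter_upwards [eventually_gt_atTop i] with n hn h
      exact absurd (h ⟨i, hn⟩) hi
  obtain ⟨n, hn⟩ := ((Finset.eventually_all _).2 h).exists
  exact ⟨n, fun x hx y hy hxy => hn (x, y) (Finset.mem_product.2 ⟨hx, hy⟩) (congrFun hxy)⟩

/-- Project many points of `R` injectively to `(ZMod 2) ^ n`; few translates of the image cover that
group, and the cylinders over the translation vectors form `U`. -/
lemma Set.Infinite.exists_isOpen_translates_cover {R : Set CantorGroup} (hR : R.Infinite)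
    {ε : ℝ} (hε : 0 < ε) :
    ∃ U : Set CantorGroup, IsOpen U ∧ coinMeasure U ≤ ENNReal.ofReal ε ∧
      ∀ x, ∃ r ∈ R, x - r ∈ U := by
  -- With `δ = ε / 2`, this makes both terms of the greedy bound at most `ε / 2 * 2 ^ n`.
  obtain ⟨m, hm⟩ := exists_nat_gt (1 / ((ε / 2) * (ε / 2)))
  obtain ⟨K, hKR, hKm⟩ := hR.exists_subset_card_eq m
  obtain ⟨n, hn⟩ := exists_injOn_restrict K
  let ρ : CantorGroup → Fin n → ZMod 2 := fun x i => x i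
  have hm0 : (0 : ℝ) < m := lt_trans (by positivity) hm
  have hcard : (K.image ρ).card = m := by rw [Finset.card_image_of_injOn hn, hKm]
  have hne : (K.image ρ).Nonempty := by
    rw [← Finset.card_pos, hcard]; exact_mod_cast hm0
  obtain ⟨V, hV, hVc⟩ := exists_cover_by_translates hne (half_pos hε) Finset.univ
  have hVε : (V.card : ℝ) ≤ ε * 2 ^ n := by
    have h1 : (1 : ℝ) / (m * (ε / 2)) ≤ ε / 2 := by
      rw [div_le_iff₀ (by positivity)]
      rw [div_lt_iff₀ (by positivity)] at hm
      linarith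
    rw [hcard, Finset.card_univ] at hVc
    have h2 : (Fintype.card (Fin n → ZMod 2) : ℝ) = 2 ^ n := by simp
    rw [h2] at hVc
    calc (V.card : ℝ) ≤ 2 ^ n / (m * (ε / 2)) + ε / 2 * 2 ^ n := hVc
      _ = 1 / (m * (ε / 2)) * 2 ^ n + ε / 2 * 2 ^ n := by ring
      _ ≤ ε / 2 * 2 ^ n + ε / 2 * 2 ^ n := by gcongr
      _ = ε * 2 ^ n := by ring
  refine ⟨ρ ⁻¹' V, ?_, ?_, fun x => ?_⟩
  · have hρ : Continuous ρ := continuous_pi fun i => continuous_apply (i : ℕ)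
    exact (isOpen_discrete (V : Set (Fin n → ZMod 2))).preimage hρ
  · have hsub : ρ ⁻¹' V ⊆ ⋃ u ∈ V, {x | ∀ i : Fin n, x i = u i} := fun x hx =>
      mem_biUnion (t := fun u : Fin n → ZMod 2 => {x : CantorGroup | ∀ i : Fin n, x i = u i})
        hx fun i => rfl
    calc coinMeasure (ρ ⁻¹' V) ≤ ∑ u ∈ V, coinMeasure {x | ∀ i : Fin n, x i = u i} :=
          (MeasureTheory.measure_mono hsub).trans (MeasureTheory.measure_biUnion_finset_le _ _)
      _ ≤ ∑ u ∈ V, (2 ^ n : ENNReal)⁻¹ :=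
          Finset.sum_le_sum fun u _ => coinMeasure_cylinder_le n u
      _ = ENNReal.ofReal V.card / 2 ^ n := by
          rw [Finset.sum_const, nsmul_eq_mul, ENNReal.ofReal_natCast, div_eq_mul_inv]
      _ ≤ ENNReal.ofReal (ε * 2 ^ n) / 2 ^ n := by gcongr
      _ = ENNReal.ofReal ε := by
          rw [ENNReal.ofReal_mul hε.le, ENNReal.ofReal_pow zero_le_two, ENNReal.ofReal_ofNat]
          exact ENNReal.mul_div_cancel_right (by simp) (by finiteness)
  · obtain ⟨k, hk, hkV⟩ := hV (ρ x) (Finset.mem_univ _)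
    obtain ⟨r, hr, rfl⟩ := Finset.mem_image.1 hk
    exact ⟨r, hKR hr, hkV⟩

/-- A null set which, in a strong sense, meets all translates of all the sets `R j`. -/
lemma exists_null_limsup {R : ℕ → Set CantorGroup} (hR : ∀ j, (R j).Infinite) :
    ∃ U : ℕ → Set CantorGroup, (∀ j, IsOpen (U j)) ∧ coinMeasure (limsup U atTop) = 0 ∧
      ∀ j x, ∃ r ∈ R j, x - r ∈ U j := by
  choose U hUo hUm hUR using fun j =>
    (hR j).exists_isOpen_translates_cover (ε := (1 / 2 : ℝ) ^ j) (by positivity)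
  refine ⟨U, hUo, MeasureTheory.measure_limsup_atTop_eq_zero ?_, hUR⟩
  refine ne_top_of_le_ne_top ?_ (ENNReal.tsum_le_tsum hUm)
  exact summable_geometric_two.tsum_ofReal_ne_top

/-! ### Strongly meager sets and Sierpiński sets -/

lemma isClosed_translate_avoiding {U : ℕ → Set CantorGroup} (hU : ∀ j, IsOpen (U j))
    (x : CantorGroup) (k : ℕ) : IsClosed {a | ∀ j ≥ k, x - a ∉ U j} := by
  simp only [ofPred_forall]
  exact isClosed_iInter fun j => isClosed_iInter fun _ =>
    ((hU j).preimage (continuous_const.sub continuous_id)).isClosed_compl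

lemma exists_mem_of_sub_notMem_limsup {U : ℕ → Set CantorGroup} {x a : CantorGroup}
    (h : x - a ∉ limsup U atTop) : ∃ k, ∀ j ≥ k, x - a ∉ U j := by
  rw [mem_limsup_iff_frequently_mem, not_frequently] at h
  exact eventually_atTop.1 h

theorem StronglyMeager.countablyPerfectlyMeager {A : Set CantorGroup} (hA : StronglyMeager A) :
    CountablyPerfectlyMeager A := by
  refine countablyPerfectlyMeager_of_cover fun R hR => ?_
  obtain ⟨U, hUo, hU0, hUR⟩ := exists_null_limsup fun j => (hR j).2.infinite (hR j).1
  obtain ⟨x, hx⟩ := (ne_univ_iff_exists_notMem _).1 (hA _ hU0)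
  refine ⟨ℕ, inferInstance, fun k => {a | ∀ j ≥ k, x - a ∉ U j},
    isClosed_translate_avoiding hUo x, fun a ha => mem_iUnion.2 ?_, fun k => ?_⟩
  · exact exists_mem_of_sub_notMem_limsup fun h =>
      hx ⟨a, ha, x - a, h, by simp⟩
  · filter_upwards [eventually_ge_atTop k] with j hj hsub
    obtain ⟨r, hr, hrU⟩ := hUR j x
    exact hsub hr j hj hrU

theorem IsSierpinskiSet.countablyPerfectlyMeager {A : Set CantorGroup}
    (hA : IsSierpinskiSet A) : CountablyPerfectlyMeager A := by
  refine countablyPerfectlyMeager_of_cover fun R hR => ?_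
  have hinf : ∀ j, (R j).Infinite := fun j => (hR j).2.infinite (hR j).1
  obtain ⟨U, hUo, hU0, hUR⟩ := exists_null_limsup hinf
  have := (hA.2 _ hU0).to_subtype
  -- The countably many points of `A` in the null set are added as singletons; the translate `x = 0`
  -- handles the others, since `-a = a`.
  refine ⟨ℕ ⊕ ↥(A ∩ limsup U atTop), inferInstance,
    Sum.elim (fun k => {a | ∀ j ≥ k, 0 - a ∉ U j}) fun a => {(a : CantorGroup)}, ?_, ?_, ?_⟩
  · rintro (k | a)
    exacts [isClosed_translate_avoiding hUo 0 k, isClosed_singleton]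
  · intro a ha
    by_cases haU : a ∈ limsup U atTop
    · exact mem_iUnion.2 ⟨Sum.inr ⟨a, ha, haU⟩, rfl⟩
    · have hneg : 0 - a = a := by
        ext i
        simp [CharTwo.neg_eq]
      obtain ⟨k, hk⟩ := exists_mem_of_sub_notMem_limsup (x := 0) (hneg.symm ▸ haU)
      exact mem_iUnion.2 ⟨Sum.inl k, hk⟩
  · rintro (k | a)
    · filter_upwards [eventually_ge_atTop k] with j hj hsub
      obtain ⟨r, hr, hrU⟩ := hUR j 0
      exact hsub hr j hj hrU
    · exact Eventually.of_forall fun j hsub => hinf j ((finite_singleton _).subset hsub)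

/-! ### Meager-additive sets -/

lemma exists_cylinder_subset {O : Set CantorGroup} (hO : IsOpen O) {x : CantorGroup}
    (hx : x ∈ O) : ∃ n, ∀ y : CantorGroup, (∀ i < n, y i = x i) → y ∈ O := by
  obtain ⟨_, ⟨z, n, rfl⟩, hxz, hzO⟩ :=
    (PiNat.isTopologicalBasis_cylinders fun _ : ℕ => ZMod 2).exists_subset_of_mem_open hx hO
  rw [PiNat.mem_cylinder_iff_eq] at hxz
  exact ⟨n, fun y hy => hzO (hxz ▸ PiNat.mem_cylinder_iff.2 hy)⟩

/-- In a perfect set, all points are split from a nearby point at a bounded level. -/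
lemma Preperfect.eventually_split {R : Set CantorGroup} (hR : Preperfect R) (n : ℕ) :
    ∀ᶠ m in atTop, ∀ r ∈ R, ∃ r' ∈ R, (∀ i < n, r' i = r i) ∧
      ∃ i, n ≤ i ∧ i < m ∧ r' i ≠ r i := by
  have key : ∀ s : Fin n → ZMod 2, ∀ᶠ m in atTop, ∀ r ∈ R, (∀ i : Fin n, r i = s i) →
      ∃ r' ∈ R, (∀ i < n, r' i = r i) ∧ ∃ i, n ≤ i ∧ i < m ∧ r' i ≠ r i := by
    intro s
    by_cases hs : ∃ p ∈ R, ∀ i : Fin n, p i = s i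
    · obtain ⟨p, hp, hps⟩ := hs
      -- A single pair `p`, `q` serves the whole cylinder: at a coordinate where they differ, every
      -- `r` differs from one of them. There are finitely many cylinders of length `n`, hence a
      -- uniform `m`.
      obtain ⟨q, ⟨hqp, hq⟩, hne⟩ := preperfect_iff_nhds.1 hR p hp (PiNat.cylinder p n)
        ((PiNat.isOpen_cylinder _ p n).mem_nhds (PiNat.self_mem_cylinder p n))
      rw [PiNat.mem_cylinder_iff] at hqp
      obtain ⟨i, hi⟩ := Function.ne_iff.1 hne
      have hni : n ≤ i := by
        by_contra h
        exact hi (hqp i (not_le.1 h))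
      filter_upwards [eventually_gt_atTop i] with m hm r _ hrs
      have hpr : ∀ l < n, p l = r l := fun l hl => (hps ⟨l, hl⟩).trans (hrs ⟨l, hl⟩).symm
      by_cases h : r i = p i
      · exact ⟨q, hq, fun l hl => (hqp l hl).trans (hpr l hl), i, hni, hm, h ▸ hi⟩
      · exact ⟨p, hp, hpr, i, hni, hm, Ne.symm h⟩
    · exact Eventually.of_forall fun m r hr hrs => absurd ⟨r, hr, hrs⟩ hs
  filter_upwards [eventually_all.2 key] with m hm r hr
  exact hm (fun i => r i) r hr fun _ => rfl

lemma exists_strictMono_split {R : ℕ → Set CantorGroup} (hR : ∀ j, Preperfect (R j)) :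
    ∃ f : ℕ → ℕ, StrictMono f ∧ ∀ k, ∀ j ≤ k, ∀ r ∈ R j, ∃ r' ∈ R j,
      (∀ i < f k, r' i = r i) ∧ ∃ i, f k ≤ i ∧ i < f (k + 1) ∧ r' i ≠ r i := by
  have step : ∀ k n : ℕ, ∃ m, n < m ∧ ∀ j ≤ k, ∀ r ∈ R j, ∃ r' ∈ R j,
      (∀ i < n, r' i = r i) ∧ ∃ i, n ≤ i ∧ i < m ∧ r' i ≠ r i := fun k n =>
    ((eventually_gt_atTop n).and
      ((finite_Iic k).eventually_all.2 fun j _ => (hR j).eventually_split n)).exists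
  choose g hg hgR using step
  let f : ℕ → ℕ := fun k => Nat.rec 0 (fun k n => g k n) k
  exact ⟨f, strictMono_nat_of_lt_succ fun k => hg k (f k), fun k => hgR k (f k)⟩

/-- The sequences which do not vanish on any of the intervals `[f k, f (k + 1))`. -/
def nonvanishingOnBlocks (f : ℕ → ℕ) : Set CantorGroup :=
  {x | ∀ k, ∃ i, f k ≤ i ∧ i < f (k + 1) ∧ x i ≠ 0}

lemma isClosed_nonvanishingOnBlocks (f : ℕ → ℕ) : IsClosed (nonvanishingOnBlocks f) := by
  have h : nonvanishingOnBlocks f =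
      ⋂ k, ⋃ i ∈ Ico (f k) (f (k + 1)), {x : CantorGroup | x i ≠ 0} := by
    ext x
    simp [nonvanishingOnBlocks, and_assoc]
  rw [h]
  refine isClosed_iInter fun k => (finite_Ico _ _).isClosed_biUnion fun i _ => ?_
  have hi : Continuous fun x : CantorGroup => x i := continuous_apply i
  exact (isClosed_discrete ({0}ᶜ : Set (ZMod 2))).preimage hi

lemma isNowhereDense_nonvanishingOnBlocks {f : ℕ → ℕ} (hf : StrictMono f) :
    IsNowhereDense (nonvanishingOnBlocks f) := by
  rw [(isClosed_nonvanishingOnBlocks f).isNowhereDense_iff, eq_empty_iff_forall_notMem]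
  intro x hx
  obtain ⟨n, hn⟩ := exists_cylinder_subset isOpen_interior hx
  -- Truncating `x` to zero from `n` on kills block `n`, because `n ≤ f n`.
  have hy := interior_subset (hn (fun i => if i < n then x i else 0) fun i hi => by simp [hi])
  obtain ⟨i, hi, -, hne⟩ := hy n
  exact hne (if_neg (not_lt.2 ((hf.id_le n).trans hi)))

lemma nonvanishingOnBlocks_nonempty {f : ℕ → ℕ} (hf : StrictMono f) :
    (nonvanishingOnBlocks f).Nonempty :=
  ⟨fun _ => 1, fun k => ⟨f k, le_rfl, hf k.lt_succ_self, one_ne_zero⟩⟩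

/-- A set `R` which splits in almost every block is large: its sum with any nonempty relatively
open subset of `nonvanishingOnBlocks f` is somewhere dense. -/
lemma exists_add_notMem_of_split {f : ℕ → ℕ} (hf : StrictMono f) {R : Set CantorGroup} {j : ℕ}
    (hne : R.Nonempty)
    (hR : ∀ k ≥ j, ∀ r ∈ R, ∃ r' ∈ R,
      (∀ i < f k, r' i = r i) ∧ ∃ i, f k ≤ i ∧ i < f (k + 1) ∧ r' i ≠ r i)
    {O : Set CantorGroup} (hO : IsOpen O) (hOM : (O ∩ nonvanishingOnBlocks f).Nonempty)
    {D : Set CantorGroup} (hD : IsNowhereDense D) :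
    ∃ r ∈ R, ∃ m ∈ O ∩ nonvanishingOnBlocks f, r + m ∉ closure D := by
  by_contra! h
  obtain ⟨m₀, hm₀O, hm₀⟩ := hOM
  obtain ⟨r, hr⟩ := hne
  obtain ⟨n, hn⟩ := exists_cylinder_subset hO hm₀O
  let l := max n j
  have hnl : n ≤ f l := (le_max_left n j).trans (hf.id_le l)
  have hsub : PiNat.cylinder (r + m₀) (f l) ⊆ closure D := by
    intro z hz
    rw [PiNat.mem_cylinder_iff] at hz
    -- Choose `r'` block by block: if `z` agrees with the current point at the splitting coordinate,
    -- switch to its split partner, which leaves earlier blocks untouched.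
    have hpath : ∀ p ≥ l, ∃ r' ∈ R, (∀ i < f l, r' i = r i) ∧
        ∀ k ≥ l, k < p → ∃ i, f k ≤ i ∧ i < f (k + 1) ∧ z i ≠ r' i := by
      intro p hp
      induction p, hp using Nat.le_induction with
      | base => exact ⟨r, hr, fun _ _ => rfl, fun k hk hk' => absurd hk (not_le.2 hk')⟩
      | succ p hp ih =>
        obtain ⟨r₁, hr₁, hr₁r, hr₁z⟩ := ih
        obtain ⟨r₂, hr₂, hr₂r, i, hi, hi', hne⟩ := hR p ((le_max_right n j).trans hp) r₁ hr₁
        by_cases hz₁ : z i = r₁ i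
        · refine ⟨r₂, hr₂, fun i hi => (hr₂r i (hi.trans_le (hf.monotone hp))).trans (hr₁r i hi),
            fun k hk hkp => ?_⟩
          rcases (Nat.lt_succ_iff.1 hkp).lt_or_eq with hkp | rfl
          · obtain ⟨i, hi, hi', hzi⟩ := hr₁z k hk hkp
            exact ⟨i, hi, hi', by rwa [hr₂r i (hi'.trans_le (hf.monotone hkp))]⟩
          · exact ⟨i, hi, hi', by rw [hz₁]; exact hne.symm⟩
        · refine ⟨r₁, hr₁, hr₁r, fun k hk hkp => ?_⟩
          rcases (Nat.lt_succ_iff.1 hkp).lt_or_eq with hkp | rfl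
          · exact hr₁z k hk hkp
          · exact ⟨i, hi, hi', hz₁⟩
    rw [← closure_closure, mem_closure_iff]
    intro V hV hzV
    obtain ⟨q, hq⟩ := exists_cylinder_subset hV hzV
    let p := max l q
    obtain ⟨r', hr', hr'r, hr'z⟩ := hpath p (le_max_left l q)
    -- Below `f p`, `r' + m` equals `z`; below `f l`, `m` equals `m₀`, which keeps it in `O`; the
    -- value 1 keeps the blocks from `p` on nonvanishing.
    let m : CantorGroup := fun i => if i < f p then z i - r' i else 1
    have hlow : ∀ i < f l, m i = m₀ i := fun i hi => by
      have hip : i < f p := hi.trans_le (hf.monotone (le_max_left l q))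
      simp [m, hip, hz i hi, hr'r i hi]
    have hmM : m ∈ nonvanishingOnBlocks f := by
      intro k
      rcases lt_or_ge k l with hkl | hlk
      · obtain ⟨i, hi, hi', hmi⟩ := hm₀ k
        exact ⟨i, hi, hi', by rwa [hlow i (hi'.trans_le (hf.monotone hkl))]⟩
      · rcases lt_or_ge k p with hkp | hpk
        · obtain ⟨i, hi, hi', hzi⟩ := hr'z k hlk hkp
          refine ⟨i, hi, hi', ?_⟩
          simpa [m, hi'.trans_le (hf.monotone hkp), sub_eq_zero] using hzi
        · refine ⟨f k, le_rfl, hf k.lt_succ_self, ?_⟩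
          simp [m, not_lt.2 (hf.monotone hpk)]
    refine ⟨r' + m, hq _ fun i hi => ?_,
      h r' hr' m ⟨hn m fun i hi => hlow i (hi.trans_le hnl), hmM⟩⟩
    have hip : i < f p := hi.trans_le ((le_max_right l q).trans (hf.id_le p))
    simp [m, hip]
  have hmem : r + m₀ ∈ interior (closure D) :=
    mem_interior.2 ⟨_, hsub, PiNat.isOpen_cylinder _ _ _, PiNat.self_mem_cylinder _ _⟩
  rw [hD] at hmem
  exact hmem

theorem MeagerAdditive.countablyPerfectlyMeager {A : Set CantorGroup} (hA : MeagerAdditive A) :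
    CountablyPerfectlyMeager A := by
  refine countablyPerfectlyMeager_of_cover fun R hR => ?_
  obtain ⟨f, hf, hfR⟩ := exists_strictMono_split fun j => (hR j).2
  let M := nonvanishingOnBlocks f
  have hMc : IsClosed M := isClosed_nonvanishingOnBlocks f
  obtain ⟨S, hS, hSc, hAS⟩ := isMeagre_iff_countable_union_isNowhereDense.1
    (hA M (isNowhereDense_nonvanishingOnBlocks hf).isMeagre)
  let B := TopologicalSpace.countableBasis CantorGroup
  have hB := TopologicalSpace.isBasis_countableBasis CantorGroup
  have := hSc.to_subtype
  have : Countable B := (TopologicalSpace.countable_countableBasis _).to_subtype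
  let ι := S × {b : B // ((b : Set CantorGroup) ∩ M).Nonempty}
  refine ⟨ι, inferInstance,
    fun s => {a | ∀ m ∈ (s.2.1 : Set CantorGroup) ∩ M, a + m ∈ closure (s.1 : Set CantorGroup)},
    fun s => ?_, fun a ha => ?_, fun s => ?_⟩
  · simp only [ofPred_forall]
    exact isClosed_iInter fun m => isClosed_iInter fun _ =>
      isClosed_closure.preimage (continuous_id.add continuous_const)
  -- Baire in `M`: the closed sets of `m` with `a + m ∈ closure D` cover `M`, so one of them
  -- contains a basic relatively open piece.
  · have : CompactSpace M := isCompact_iff_compactSpace.1 hMc.isCompact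
    have : Nonempty M := (nonvanishingOnBlocks_nonempty hf).to_subtype
    obtain ⟨D, x, hx⟩ := nonempty_interior_of_iUnion_of_closed
      (f := fun D : S => {m : M | a + (m : CantorGroup) ∈ closure (D : Set CantorGroup)})
      (fun D => isClosed_closure.preimage (continuous_const.add continuous_subtype_val))
      (eq_univ_of_forall fun m => by
        obtain ⟨D, hD, hmD⟩ := hAS (add_mem_add ha m.2)
        exact mem_iUnion.2 ⟨⟨D, hD⟩, subset_closure hmD⟩)
    obtain ⟨V, hV, hVo, hxV⟩ := mem_interior.1 hx
    obtain ⟨U, hU, rfl⟩ := isOpen_induced_iff.1 hVo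
    obtain ⟨b, hb, hxb, hbU⟩ := hB.exists_subset_of_mem_open hxV hU
    exact mem_iUnion.2 ⟨(D, ⟨⟨b, hb⟩, x, hxb, x.2⟩), fun m hm =>
      hV (show (⟨m, hm.2⟩ : M) ∈ _ from hbU hm.1)⟩
  · refine Eventually.of_forall fun j hsub => ?_
    obtain ⟨r, hr, m, hm, hrm⟩ := exists_add_notMem_of_split hf (hR j).1
      (fun k hk => hfR k j hk) (hB.isOpen s.2.1.2) s.2.2 (hS _ s.1.2)
    exact hrm (hsub hr m hm)

theorem mainTheorem10 :
    (∀ A : Set CantorGroup, MeagerAdditive A → CountablyPerfectlyMeager A) ∧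
    (∀ A : Set CantorGroup, IsGammaSet A → CountablyPerfectlyMeager A) ∧
    (∀ A : Set CantorGroup, StronglyMeager A → CountablyPerfectlyMeager A) ∧
    (∀ A : Set CantorGroup, IsSierpinskiSet A → CountablyPerfectlyMeager A) :=
  ⟨fun _ => MeagerAdditive.countablyPerfectlyMeager,
    fun _ => IsGammaSet.countablyPerfectlyMeager,
    fun _ => StronglyMeager.countablyPerfectlyMeager,
    fun _ => IsSierpinskiSet.countablyPerfectlyMeager⟩
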